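/- Let $F$ be a field. Algebras over $F$ are associative and not necessarily unital; such an algebra $R$ is called Jacobson radical if it coincides with its Jacobson radical, that is, if every $a\in R$ is quasi-regular: there is $b\in R$ with $a+b+ab=a+b+ba=0$. Let $A$ be a Jacobson radical $F$-algebra of at most countable dimension over $F$. Then there exist a finitely generated Jacobson radical $F$-algebra $C$ and an injective homomorphism of $F$-algebras $A\to C$. (Finitely generated means: generated by a finite subset as a not necessarily unital $F$-algebra.) -/

import Mathlib

universe u v

/-- A (not necessarily unital, associative) ring or algebra is *Jacobson radical* if each of its
elements is quasiregular, that is, if `a ∘ b = a + b + a * b` makes it a group. -/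
def IsJacobsonRadical (A : Type*) [NonUnitalRing A] : Prop :=
  ∀ a : A, IsQuasiregular a

/-- A (not necessarily unital, associative) algebra over a field is *finitely generated* if it is
the smallest non-unital subalgebra containing some finite set. -/
def IsFinitelyGeneratedAlgebra (F A : Type*) [Field F] [NonUnitalRing A] [Module F A]
    [IsScalarTower F A A] [SMulCommClass F A A] : Prop :=
  ∃ s : Finset A, NonUnitalAlgebra.adjoin F (s : Set A) = ⊤

/-!
The algebra `C` is built from two ingredients: a finitely generated infinite-dimensional nil
algebra and a matrix wreath product.

Nil algebra. Let `T` be the free algebra on four letters over `F`. For a finite set `W` of nonempty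
words, the `m`-th powers of all combinations of `W` lie in the span of one homogeneous element for
each multiset of size `m` in `W` (`exists_sum_smul_pow_expansion`). The number of these multisets
is polynomial in `m` and their degrees are at least `m`, so for large `m` they are negligible when
a relation of degree `d` is given the weight `(1 / 2) ^ d`. By the Golod–Shafarevich estimate
(`relSpan_succ_le`, `relSpan_lt_wordSpan`), killing them all, for a suitable `m` for each `W`,
leaves an infinite-dimensional algebra `Q` in which every polynomial in the generators without
constant term is nilpotent (`exists_infinite_dimensional_nil`). As the sets `W` are finite sets of
words, there are countably many of them, whatever the size of `F`.

Wreath product. Let `U` be the unitization of `A`. On `U × (Q ⊗ U)` consider the operators `diag q`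
(left multiplication by `q` on the second summand), `column : (p, t) ↦ (0, 1 ⊗ p)` and
`row : (p, q ⊗ p') ↦ (γ q * p', 0)`, for a linear surjection `γ : Q → A`, which exists because `A` has countable
dimension. Then `C` is generated by `row`, `column` and the `diag x` with `x` a generator of `Q`.
It contains the copy of `A` acting by left multiplication on the first summand, because
`row * diag q * column` is the action of `γ q` (`WreathSpace.corner_mem_adjoin`).

To see that `C` is Jacobson radical, note that `row * z * row = α * row` for each `z` in `C`, with
some `α` in `A` (`WreathSpace.row_mul_absorbs`); the quasi-inverse of `α` gives one of `row * z`,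
so `row` lies in the radical (`mem_radicalPart_of_absorbs`). As `column * column` and
`column * diag q` vanish, `column` generates a nilpotent right ideal modulo the radical, so it lies in the
radical too, and modulo the radical `C` is generated by the nil algebra of the `diag b`
(`isJacobsonRadical_of_mem_radicalPart`).
-/

/-! ### The Golod–Shafarevich estimate -/

section Graded

variable (F : Type*) {T : Type*} [Field F] [Ring T] [Algebra F T]

/-- The homogeneous component of degree `n` of the free algebra on four letters: the span of the
words of length `n`. The free algebra is any algebra `T` with a multiplicative map `ω` from the free
monoid whose values form a basis. -/
def wordSpan (ω : FreeMonoid (Fin 4) →* T) (n : ℕ) : Submodule F T :=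
  Submodule.span F (ω '' {w | w.length = n})

/-- The component of degree `n` of the two-sided ideal generated by homogeneous elements `r i` of
degree `d i`: the span of the products `u * r i * v` of total degree `n`, with `u` and `v` words. -/
def relSpan (ω : FreeMonoid (Fin 4) →* T) {ι : Type*} (r : ι → T) (d : ι → ℕ) (n : ℕ) :
    Submodule F T :=
  Submodule.span F {x | ∃ u i v, x = ω u * r i * ω v ∧ u.length + d i + v.length = n}

variable {F} {ω : FreeMonoid (Fin 4) →* T}

lemma word_mem_wordSpan (w : FreeMonoid (Fin 4)) : ω w ∈ wordSpan F ω w.length :=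
  Submodule.subset_span ⟨w, rfl, rfl⟩

lemma mul_mem_wordSpan {m n : ℕ} {a b : T}
    (ha : a ∈ wordSpan F ω m) (hb : b ∈ wordSpan F ω n) : a * b ∈ wordSpan F ω (m + n) := by
  have := Submodule.mul_mem_mul ha hb
  rw [wordSpan, wordSpan, Submodule.span_mul_span] at this
  refine Submodule.span_mono ?_ this
  rintro _ ⟨_, ⟨u, rfl, rfl⟩, _, ⟨v, rfl, rfl⟩, rfl⟩
  exact ⟨u * v, by simp, by simp only [map_mul]⟩

lemma wordSpan_eq_span_range (n : ℕ) : wordSpan F ω n =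
    Submodule.span F (Set.range fun g : Fin n → Fin 4 => ω (FreeMonoid.ofList (List.ofFn g))) := by
  unfold wordSpan
  congr 1
  ext x
  constructor
  · rintro ⟨w, hw, rfl⟩
    have hw' : (FreeMonoid.toList w).length = n := hw
    subst hw'
    exact ⟨(FreeMonoid.toList w).get, by simp⟩
  · rintro ⟨g, rfl⟩
    exact ⟨_, by simp [FreeMonoid.length], rfl⟩

instance (n : ℕ) : FiniteDimensional F (wordSpan F ω n) := by
  rw [wordSpan_eq_span_range]
  exact FiniteDimensional.span_of_finite F (Set.finite_range _)

lemma finrank_wordSpan (hω : LinearIndependent F ω) (n : ℕ) :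
    Module.finrank F (wordSpan F ω n) = 4 ^ n := by
  rw [wordSpan_eq_span_range, finrank_span_eq_card]
  · simp
  · exact hω.comp _ fun g h hgh => List.ofFn_injective (FreeMonoid.ofList.injective hgh)

variable {ι : Type*} {r : ι → T} {d : ι → ℕ}

lemma relSpan_le_wordSpan (hr : ∀ i, r i ∈ wordSpan F ω (d i)) (n : ℕ) :
    relSpan F ω r d n ≤ wordSpan F ω n := by
  refine Submodule.span_le.2 ?_
  rintro _ ⟨u, i, v, rfl, rfl⟩
  exact mul_mem_wordSpan (mul_mem_wordSpan (word_mem_wordSpan u) (hr i)) (word_mem_wordSpan v)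

lemma mul_word_mem_relSpan {n : ℕ} {x : T} (hx : x ∈ relSpan F ω r d n) (w : FreeMonoid (Fin 4)) :
    x * ω w ∈ relSpan F ω r d (n + w.length) := by
  have h : relSpan F ω r d n ≤ (relSpan F ω r d (n + w.length)).comap
      (LinearMap.mulRight F (ω w)) := by
    refine Submodule.span_le.2 ?_
    rintro _ ⟨u, i, v, rfl, rfl⟩
    refine Submodule.subset_span ⟨u, i, v * w, ?_, ?_⟩
    · simp only [map_mul, LinearMap.mulRight_apply, mul_assoc]
    · simp only [FreeMonoid.length_mul]; ring
  exact h hx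

lemma exists_compl_relSpan (hω : LinearIndependent F ω) (hr : ∀ i, r i ∈ wordSpan F ω (d i))
    (n : ℕ) :
    ∃ A : Submodule F T, A ≤ wordSpan F ω n ∧ wordSpan F ω n ≤ A ⊔ relSpan F ω r d n ∧
      Module.finrank F A + Module.finrank F (relSpan F ω r d n) = 4 ^ n := by
  obtain ⟨A, hA⟩ := exists_isCompl (relSpan F ω r d n)
  have h1 : A ⊓ wordSpan F ω n ⊔ relSpan F ω r d n = wordSpan F ω n := by
    rw [sup_comm, ← sup_inf_assoc_of_le _ (relSpan_le_wordSpan hr n), hA.sup_eq_top, top_inf_eq]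
  have h2 : A ⊓ wordSpan F ω n ⊓ relSpan F ω r d n = ⊥ := by
    rw [eq_bot_iff, ← hA.inf_eq_bot]
    exact le_inf inf_le_right (inf_le_left.trans inf_le_left)
  have : FiniteDimensional F ↥(A ⊓ wordSpan F ω n) :=
    Submodule.finiteDimensional_of_le (inf_le_right : _ ≤ wordSpan F ω n)
  have : FiniteDimensional F (relSpan F ω r d n) :=
    Submodule.finiteDimensional_of_le (relSpan_le_wordSpan hr n)
  refine ⟨A ⊓ wordSpan F ω n, inf_le_right, h1.ge, ?_⟩
  rw [← finrank_wordSpan hω n, ← Submodule.finrank_sup_add_finrank_inf_eq, h1, h2]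
  simp

lemma finrank_finset_sup_le {V κ : Type*} [AddCommGroup V] [Module F V]
    (s : Finset κ) (p : κ → Submodule F V) [∀ i, FiniteDimensional F (p i)] :
    Module.finrank F ↥(s.sup p) ≤ ∑ i ∈ s, Module.finrank F (p i) := by
  classical
  induction s using Finset.induction_on with
  | empty => rw [Finset.sup_empty]; simp
  | insert a s ha ih =>
    rw [Finset.sup_insert, Finset.sum_insert ha]
    have := Submodule.finite_finset_sup s p
    exact (Submodule.finrank_add_le_finrank_add_finrank _ _).trans (Nat.add_le_add_left ih _)

/-- Multiplying the ideal on the right by a form of positive degree factors through multiplying it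
by letters. -/
lemma mul_mem_sup_map_relSpan {n m k : ℕ} (hmk : m + k = n + 1) (hk : 1 ≤ k)
    {x : T} (hx : x ∈ relSpan F ω r d m) {y : T} (hy : y ∈ wordSpan F ω k) :
    x * y ∈ Finset.univ.sup fun a : Fin 4 => (relSpan F ω r d n).map
      (LinearMap.mulRight F (ω (FreeMonoid.of a))) := by
  unfold wordSpan at hy
  induction hy using Submodule.span_induction with
  | mem y h =>
    obtain ⟨w, hw, rfl⟩ := h
    simp only [Set.mem_ofPred_eq] at hw
    obtain ⟨w', a, rfl⟩ : ∃ w' a, w = w' * FreeMonoid.of a := by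
      have h0 : w.toList ≠ [] := by
        intro h0
        have : w.length = 0 := by simp [FreeMonoid.length, h0]
        omega
      refine ⟨FreeMonoid.ofList (w.toList.dropLast), w.toList.getLast h0, ?_⟩
      apply FreeMonoid.toList.injective
      simpa [FreeMonoid.toList_mul] using (List.dropLast_append_getLast h0).symm
    simp only [FreeMonoid.length_mul, FreeMonoid.length_of] at hw
    obtain rfl : m + w'.length = n := by omega
    refine (Finset.le_sup (f := fun a : Fin 4 => (relSpan F ω r d (m + w'.length)).map
      (LinearMap.mulRight F (ω (FreeMonoid.of a)))) (Finset.mem_univ a)) ?_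
    exact ⟨x * ω w', mul_word_mem_relSpan hx w', by
      simp only [map_mul, LinearMap.mulRight_apply, mul_assoc]⟩
  | zero => simp
  | add y z _ _ hy hz => rw [mul_add]; exact Submodule.add_mem _ hy hz
  | smul c y _ hy => rw [mul_smul_comm]; exact Submodule.smul_mem _ c hy

/-- With `A m` a complement of the ideal in degree `m`, the ideal in degree `n + 1` is covered by
the right multiples by letters of the ideal in degree `n` and by the spaces `A (n + 1 - d i) * r i`:
in a product `u * r i * v` with `v = 1`, split `u` along the complement. -/
lemma relSpan_succ_le (hr : ∀ i, r i ∈ wordSpan F ω (d i)) (hd : ∀ i, 1 ≤ d i)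
    (A : ℕ → Submodule F T) (hA : ∀ n, wordSpan F ω n ≤ A n ⊔ relSpan F ω r d n) (n : ℕ)
    (s : Finset ι) (hs : ∀ i, d i ≤ n + 1 → i ∈ s) :
    relSpan F ω r d (n + 1) ≤ (Finset.univ.sup fun a : Fin 4 => (relSpan F ω r d n).map
      (LinearMap.mulRight F (ω (FreeMonoid.of a)))) ⊔
      s.sup fun i => (A (n + 1 - d i)).map (LinearMap.mulRight F (r i)) := by
  refine Submodule.span_le.2 ?_
  rintro _ ⟨u, i, v, rfl, huv⟩
  rw [SetLike.mem_coe]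
  by_cases hv : v.length = 0
  · obtain rfl : v = 1 := FreeMonoid.length_eq_zero.1 hv
    rw [map_one, mul_one]
    rw [FreeMonoid.length_one, add_zero] at huv
    have hu : n + 1 - d i = u.length := by omega
    obtain ⟨a, ha, b, hb, hab⟩ := Submodule.mem_sup.1 (hA _ (word_mem_wordSpan (F := F) u))
    rw [← hab, add_mul, add_comm (a * r i)]
    refine Submodule.add_mem_sup (mul_mem_sup_map_relSpan huv (hd i) hb (hr i)) ?_
    refine (Finset.le_sup (f := fun i => (A (n + 1 - d i)).map (LinearMap.mulRight F (r i)))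
      (hs i (by omega))) ?_
    exact ⟨a, by rwa [hu], rfl⟩
  · refine Submodule.mem_sup_left ?_
    refine mul_mem_sup_map_relSpan (m := u.length + d i) huv (by omega) ?_ (word_mem_wordSpan v)
    exact Submodule.subset_span ⟨u, i, 1, by simp, by simp⟩

lemma finrank_relSpan_succ_le (hr : ∀ i, r i ∈ wordSpan F ω (d i)) (hd : ∀ i, 1 ≤ d i)
    (A : ℕ → Submodule F T) (hAle : ∀ n, A n ≤ wordSpan F ω n)
    (hA : ∀ n, wordSpan F ω n ≤ A n ⊔ relSpan F ω r d n) (n : ℕ) (s : Finset ι)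
    (hs : ∀ i, d i ≤ n + 1 → i ∈ s) :
    Module.finrank F (relSpan F ω r d (n + 1)) ≤ 4 * Module.finrank F (relSpan F ω r d n) +
      ∑ i ∈ s, Module.finrank F (A (n + 1 - d i)) := by
  have hfr : ∀ n, FiniteDimensional F (relSpan F ω r d n) := fun n =>
    Submodule.finiteDimensional_of_le (relSpan_le_wordSpan hr n)
  have hfA : ∀ n, FiniteDimensional F (A n) := fun n =>
    Submodule.finiteDimensional_of_le (hAle n)
  have hf1 := Submodule.finite_finset_sup Finset.univ fun a : Fin 4 => (relSpan F ω r d n).map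
      (LinearMap.mulRight F (ω (FreeMonoid.of a)))
  have hf2 := Submodule.finite_finset_sup s fun i => (A (n + 1 - d i)).map
      (LinearMap.mulRight F (r i))
  refine (Submodule.finrank_mono (relSpan_succ_le hr hd A hA n s hs)).trans ?_
  refine (Submodule.finrank_add_le_finrank_add_finrank _ _).trans (Nat.add_le_add ?_ ?_)
  · refine (finrank_finset_sup_le _ _).trans ?_
    refine (Finset.sum_le_sum fun a _ => Submodule.finrank_map_le _ _).trans ?_
    simp
  · refine (finrank_finset_sup_le _ _).trans ?_
    exact Finset.sum_le_sum fun a _ => Submodule.finrank_map_le _ _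

/-- The numerical half of the Golod–Shafarevich theorem: the codimensions `b n` at least double.
With four letters and growth rate `2`, the terms `b (n + 1 - d i) ≤ 2 * (1 / 2) ^ d i * b n` add up to at
most `2 * b n`. -/
lemma two_mul_le_of_golod_shafarevich {b : ℕ → ℝ} (hd : ∀ i, 1 ≤ d i)
    (hsum : ∀ s : Finset ι, ∑ i ∈ s, (1 / 2 : ℝ) ^ d i ≤ 1) (hb0 : ∀ n, 0 ≤ b n)
    (h : ∀ n, ∃ s : Finset ι, (∀ i ∈ s, d i ≤ n + 1) ∧
      4 * b n ≤ b (n + 1) + ∑ i ∈ s, b (n + 1 - d i)) (n : ℕ) : 2 * b n ≤ b (n + 1) := by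
  induction n using Nat.strong_induction_on with
  | _ n ih =>
    have hle : ∀ k ≤ n, b (n - k) ≤ (1 / 2 : ℝ) ^ k * b n := by
      intro k
      induction k with
      | zero => simp
      | succ k ihk =>
        intro hk
        have h1 := ih (n - (k + 1)) (by omega)
        have h2 := ihk (by omega)
        rw [show n - (k + 1) + 1 = n - k by omega] at h1
        rw [pow_succ]
        linarith
    obtain ⟨s, hs, h4⟩ := h n
    have h5 : ∑ i ∈ s, b (n + 1 - d i) ≤ ∑ i ∈ s, (1 / 2 : ℝ) ^ d i * (2 * b n) := by
      refine Finset.sum_le_sum fun i hi => ?_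
      obtain ⟨k, hk⟩ := Nat.exists_eq_add_of_le (hd i)
      have h6 := hle k (by have := hs i hi; omega)
      rw [show n + 1 - d i = n - k by omega, hk, pow_add]
      linarith
    rw [← Finset.sum_mul] at h5
    have h7 := mul_le_mul_of_nonneg_right (hsum s) (by linarith [hb0 n] : 0 ≤ 2 * b n)
    linarith

/-- **Golod–Shafarevich theorem**: if the relations are few, weighted by `(1 / 2) ^ deg`, then the
ideal they generate misses some form of each degree. -/
theorem relSpan_lt_wordSpan (hω : LinearIndependent F ω) (hr : ∀ i, r i ∈ wordSpan F ω (d i))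
    (hd : ∀ i, 1 ≤ d i) (hsum : ∀ s : Finset ι, ∑ i ∈ s, (1 / 2 : ℝ) ^ d i ≤ 1)
    (hfin : ∀ n, {i | d i ≤ n}.Finite) (n : ℕ) :
    ∃ x ∈ wordSpan F ω n, x ∉ relSpan F ω r d n := by
  choose A hAle hA hAr using exists_compl_relSpan (r := r) (d := d) hω hr
  have hpos : ∀ n, (0 : ℝ) < Module.finrank F (A n) := by
    have h2 := two_mul_le_of_golod_shafarevich (d := d)
      (b := fun n => (Module.finrank F (A n) : ℝ)) hd hsum (fun n => Nat.cast_nonneg _)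
      fun n => ⟨(hfin (n + 1)).toFinset, fun i hi => by simpa using hi, by
        have h3 := finrank_relSpan_succ_le hr hd A hAle hA n (hfin (n + 1)).toFinset
          fun i hi => by simpa using hi
        have h4 := hAr n
        have h5 := hAr (n + 1)
        rw [pow_succ] at h5
        have : 4 * Module.finrank F (A n) ≤ Module.finrank F (A (n + 1)) +
          ∑ i ∈ (hfin (n + 1)).toFinset, Module.finrank F (A (n + 1 - d i)) := by omega
        exact_mod_cast this⟩
    intro n
    induction n with
    | zero =>
      have h0 : relSpan F ω r d 0 = ⊥ := by
        refine Submodule.span_eq_bot.2 ?_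
        rintro _ ⟨u, i, v, rfl, h⟩
        have := hd i
        omega
      have := hAr 0
      rw [h0, finrank_bot] at this
      have h1 : Module.finrank F (A 0) = 1 := by simpa using this
      rw [h1]; simp
    | succ n ih => linarith [h2 n]
  by_contra! hcon
  have hle : A n ≤ relSpan F ω r d n := fun x hx => hcon x (hAle n hx)
  have hle' : wordSpan F ω n ≤ relSpan F ω r d n := fun x hx => hcon x hx
  have h1 := hAr n
  have h2 := hpos n
  have : FiniteDimensional F (relSpan F ω r d n) :=
    Submodule.finiteDimensional_of_le (relSpan_le_wordSpan hr n)
  have h3 := Submodule.finrank_mono hle'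
  rw [finrank_wordSpan hω] at h3
  have h4 : 0 < Module.finrank F (A n) := by exact_mod_cast h2
  omega

end Graded

/-! ### Infinite-dimensional quotients of the free algebra -/

section Quotient

open scoped Pointwise

variable {F T : Type*} [Field F] [Ring T] [Algebra F T] {ω : FreeMonoid (Fin 4) →* T}

/-- The projection onto a homogeneous component. -/
lemma exists_wordProj (hω : LinearIndependent F ω) (hspan : ⊤ ≤ Submodule.span F (Set.range ω))
    (n : ℕ) : ∃ p : T →ₗ[F] T, ∀ m, ∀ x ∈ wordSpan F ω m, p x = if m = n then x else 0 := by
  refine ⟨(Module.Basis.mk hω hspan).constr F fun w => if w.length = n then ω w else 0, ?_⟩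
  have hp (w : FreeMonoid (Fin 4)) : (Module.Basis.mk hω hspan).constr F
      (fun w => if w.length = n then ω w else 0) (ω w) = if w.length = n then ω w else 0 := by
    conv_lhs => rw [← Module.Basis.mk_apply hω hspan w]
    exact Module.Basis.constr_basis _ _ _ _
  intro m x hx
  unfold wordSpan at hx
  induction hx using Submodule.span_induction with
  | mem x h =>
    obtain ⟨w, hw, rfl⟩ := h
    rw [hp]
    simp only [Set.mem_ofPred_eq] at hw
    rw [hw]
  | zero => simp
  | add x y _ _ hx hy => rw [map_add, hx, hy]; split_ifs <;> simp
  | smul c x _ hx => rw [map_smul, hx]; split_ifs <;> simp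

variable {ι : Type*} {r : ι → T} {d : ι → ℕ}

/-- An algebra presented by few homogeneous relations is infinite-dimensional. -/
theorem exists_ideal_not_finite_quotient (hω : LinearIndependent F ω)
    (hspan : ⊤ ≤ Submodule.span F (Set.range ω)) (hr : ∀ i, r i ∈ wordSpan F ω (d i))
    (hd : ∀ i, 1 ≤ d i) (hsum : ∑' i, (2⁻¹ : ENNReal) ^ d i ≤ 1) :
    ∃ I : Ideal T, I.IsTwoSided ∧ (∀ i, r i ∈ I) ∧ ¬ Module.Finite F (T ⧸ I) := by
  have hsum' : ∀ s : Finset ι, ∑ i ∈ s, (1 / 2 : ℝ) ^ d i ≤ 1 := by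
    intro s
    have h1 := (ENNReal.sum_le_tsum (f := fun i => (2⁻¹ : ENNReal) ^ d i) s).trans hsum
    have h2 := ENNReal.toReal_mono ENNReal.one_ne_top h1
    rw [ENNReal.toReal_sum (fun i _ => by simp)] at h2
    simpa using h2
  have hfin : ∀ n, {i | d i ≤ n}.Finite := by
    intro n
    refine (ENNReal.finite_const_le_of_tsum_ne_top (ne_top_of_le_ne_top ENNReal.one_ne_top hsum)
      (ε := 2⁻¹ ^ n) (by simp)).subset fun i hi => ?_
    exact pow_le_pow_of_le_one zero_le (ENNReal.inv_le_one.2 one_le_two) hi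
  have hspan' : Submodule.span F (Set.range ω) = ⊤ := top_le_iff.1 hspan
  set I : Ideal T := Ideal.span {x | ∃ i v, x = r i * ω v} with hI
  have hIspan : I.restrictScalars F =
      Submodule.span F (Set.range ω • {x | ∃ i v, x = r i * ω v}) :=
    (Submodule.span_smul_of_span_eq_top hspan' _).symm
  have hright : ∀ x ∈ I, ∀ w, x * ω w ∈ I := by
    intro x hx w
    refine (Submodule.span_le (p := Submodule.comap (LinearMap.toSpanSingleton T T (ω w)) I)).2
      ?_ hx
    rintro _ ⟨i, v, rfl⟩
    refine Ideal.subset_span ⟨i, v * w, ?_⟩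
    simp [mul_assoc]
  have htwo : I.IsTwoSided := by
    refine ⟨fun {x} y hx => ?_⟩
    have hy : y ∈ Submodule.span F (Set.range ω) := hspan' ▸ Submodule.mem_top
    induction hy using Submodule.span_induction with
    | mem y h => obtain ⟨w, rfl⟩ := h; exact hright x hx w
    | zero => simp
    | add y z _ _ hy hz => rw [mul_add]; exact I.add_mem hy hz
    | smul c y _ hy =>
      rw [mul_smul_comm]; exact (I.restrictScalars F).smul_mem c hy
  refine ⟨I, htwo, fun i => Ideal.subset_span ⟨i, 1, by simp⟩, fun hfinite => ?_⟩
  choose p hp using exists_wordProj hω hspan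
  choose t ht htr using relSpan_lt_wordSpan hω hr hd hsum' hfin
  have hpI : ∀ n, ∀ x ∈ I, p n x ∈ relSpan F ω r d n := by
    intro n x hx
    have hx' : x ∈ I.restrictScalars F := hx
    rw [hIspan] at hx'
    refine (Submodule.span_le (p := (relSpan F ω r d n).comap (p n))).2 ?_ hx'
    rintro _ ⟨_, ⟨u, rfl⟩, _, ⟨i, v, rfl⟩, rfl⟩
    have hmem : ω u * r i * ω v ∈ relSpan F ω r d (u.length + d i + v.length) :=
      Submodule.subset_span ⟨u, i, v, rfl, rfl⟩
    simp only [SetLike.mem_coe, Submodule.mem_comap]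
    rw [← mul_assoc, hp n _ _ (relSpan_le_wordSpan hr _ hmem)]
    split_ifs with h
    · exact h ▸ hmem
    · exact Submodule.zero_mem _
  have hli : LinearIndependent F fun n => Ideal.Quotient.mkₐ F I (t n) := by
    rw [linearIndependent_iff']
    intro s g hg n hn
    have h1 : ∑ i ∈ s, g i • t i ∈ I := by
      rw [← Ideal.Quotient.eq_zero_iff_mem, ← Ideal.Quotient.mkₐ_eq_mk F]
      simpa using hg
    have h2 := hpI n _ h1
    rw [map_sum, Finset.sum_eq_single n (fun m _ hmn => by
      rw [map_smul, hp n m _ (ht m), if_neg hmn, smul_zero]) (fun h => (h hn).elim), map_smul,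
      hp n n _ (ht n), if_pos rfl] at h2
    by_contra hgn
    exact htr n (by simpa [smul_smul, hgn] using (relSpan F ω r d n).smul_mem (g n)⁻¹ h2)
  exact Module.Finite.not_linearIndependent_of_infinite _ hli

end Quotient

/-! ### Expansion of powers -/

section Expansion

/-- Noncommutative multinomial expansion over sequences of indices. -/
lemma sum_pow_eq_sum_prod_ofFn {κ T : Type*} [Fintype κ] [Semiring T] (a : κ → T) (m : ℕ) :
    (∑ k, a k) ^ m = ∑ g : Fin m → κ, ((List.ofFn g).map a).prod := by
  induction m with
  | zero => simp
  | succ m ih =>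
    rw [pow_succ', ih, Finset.sum_mul_sum, ← Finset.sum_product', Finset.univ_product_univ]
    refine Fintype.sum_equiv (Fin.consEquiv fun _ => κ) _ _ fun x => ?_
    simp [Fin.consEquiv, List.ofFn_succ]

lemma List.prod_map_smul_eq {κ F T : Type*} [CommSemiring F] [Semiring T] [Algebra F T]
    (c : κ → F) (a : κ → T) (l : List κ) :
    (l.map fun k => c k • a k).prod = (l.map c).prod • (l.map a).prod := by
  induction l with
  | nil => simp
  | cons k l ih => simp only [List.map_cons, List.prod_cons, ih, smul_mul_smul_comm]

/-- The `m`-th powers of all linear combinations of `a k` are combinations of finitely many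
elements, one for each multiset of size `m`: the sum of the products of `a` over the orderings of
the multiset. If the `a k` are homogeneous then so are these sums. -/
lemma exists_sum_smul_pow_expansion {κ F T : Type*} [Fintype κ] [DecidableEq κ] [Field F] [Ring T]
    [Algebra F T] {ω : FreeMonoid (Fin 4) →* T} (a : κ → T) (δ : κ → ℕ)
    (ha : ∀ k, a k ∈ wordSpan F ω (δ k)) (m : ℕ) :
    ∃ S : Sym κ m → T, (∀ e : Sym κ m, S e ∈ wordSpan F ω ((e : Multiset κ).map δ).sum) ∧
      ∀ c : κ → F, (∑ k, c k • a k) ^ m = ∑ e : Sym κ m, ((e : Multiset κ).map c).prod • S e := by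
  let q : (Fin m → κ) → Sym κ m := fun g => ⟨(List.ofFn g : Multiset κ), by simp⟩
  refine ⟨fun e => ∑ g with q g = e, ((List.ofFn g).map a).prod, fun e => ?_, fun c => ?_⟩
  · refine Submodule.sum_mem _ fun g hg => ?_
    obtain rfl : q g = e := by simpa using hg
    have hl : ∀ l : List κ, (l.map a).prod ∈ wordSpan F ω (l.map δ).sum := by
      intro l
      induction l with
      | nil => simpa using word_mem_wordSpan (F := F) (ω := ω) 1
      | cons k l ih => simpa using mul_mem_wordSpan (ha k) ih
    simpa [q] using hl (List.ofFn g)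
  · rw [sum_pow_eq_sum_prod_ofFn, ← Finset.sum_fiberwise _ q]
    refine Finset.sum_congr rfl fun e _ => ?_
    rw [Finset.smul_sum]
    refine Finset.sum_congr rfl fun g hg => ?_
    obtain rfl : q g = e := by simpa using hg
    rw [List.prod_map_smul_eq]
    simp only [q, Sym.coe_mk, Multiset.map_coe, Multiset.prod_coe]

lemma Multiset.card_le_sum_map {κ : Type*} (s : Multiset κ) (δ : κ → ℕ) (h : ∀ k, 1 ≤ δ k) :
    s.card ≤ (s.map δ).sum := by
  induction s using Multiset.induction_on with
  | empty => simp
  | cons k s ih => have := h k; simp; omega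

/-- The number of multisets of size `m` grows polynomially with `m`. -/
lemma exists_card_sym_mul_pow_le (κ : Type*) [Fintype κ] [DecidableEq κ] {ε : ENNReal}
    (hε : 0 < ε) :
    ∃ m, 1 ≤ m ∧ (Fintype.card (Sym κ m) : ENNReal) * 2⁻¹ ^ m ≤ ε := by
  set N := Fintype.card κ with hN
  have hcard : ∀ m, 1 ≤ m → Fintype.card (Sym κ m) ≤ (m + N) ^ N := by
    intro m hm
    rw [Sym.card_sym_eq_choose, ← hN]
    rcases Nat.eq_zero_or_pos N with h0 | h0
    · rw [Nat.choose_eq_zero_of_lt (by omega)]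
      exact Nat.zero_le _
    · rw [← Nat.choose_symm (by omega)]
      exact (Nat.choose_le_pow _ _).trans ((Nat.pow_le_pow_left (by omega) _).trans
        (Nat.pow_le_pow_right (by omega) (by omega : N + m - 1 - m ≤ N)))
  have h1 : Filter.Tendsto (fun n : ℕ => (n : ℝ) ^ N / 2 ^ n) Filter.atTop (nhds 0) :=
    tendsto_pow_const_div_const_pow_of_one_lt N one_lt_two
  have h2 := (h1.comp (Filter.tendsto_add_atTop_nat N)).const_mul (2 ^ N : ℝ)
  rw [mul_zero] at h2
  have h3 := (ENNReal.tendsto_ofReal h2)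
  rw [ENNReal.ofReal_zero] at h3
  obtain ⟨m, hm, hm1⟩ := ((h3.eventually (ge_mem_nhds hε)).and
    (Filter.eventually_ge_atTop 1)).exists
  refine ⟨m, hm1, le_trans ?_ hm⟩
  have h4 : (2 : ℝ) ^ N * (((m + N : ℕ) : ℝ) ^ N / 2 ^ (m + N)) =
      (((m + N) ^ N : ℕ) : ℝ) * (2⁻¹) ^ m := by
    rw [pow_add, inv_pow]; push_cast; field_simp
  rw [Function.comp_apply, h4, ENNReal.ofReal_mul (by positivity), ENNReal.ofReal_natCast,
    ENNReal.ofReal_pow (by positivity), ENNReal.ofReal_inv_of_pos (by positivity)]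
  gcongr
  · exact hcard m hm1
  · simp

end Expansion

/-! ### A finitely generated infinite-dimensional nil algebra -/

section NilAlgebra

/-- Finite sets of nonempty words, as supports of elements without constant term. -/
abbrev WordSupport : Type := {W : Finset (FreeMonoid (Fin 4)) // 1 ∉ W}

open Classical in
/-- **Golod's theorem**: over every field there is an infinite-dimensional algebra with finitely
many generators such that all polynomials in the generators without constant term are nilpotent. -/
theorem exists_infinite_dimensional_nil (F : Type u) [Field F] :
    ∃ (Q : Type u) (_ : Ring Q) (_ : Algebra F Q) (s : Finset Q),
      Algebra.adjoin F (s : Set Q) = ⊤ ∧ ¬ Module.Finite F Q ∧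
        ∀ b ∈ NonUnitalAlgebra.adjoin F (s : Set Q), IsNilpotent b := by
  set T := MonoidAlgebra F (FreeMonoid (Fin 4))
  set ω : FreeMonoid (Fin 4) →* T := MonoidAlgebra.of F (FreeMonoid (Fin 4)) with hω
  have hbasis : (MonoidAlgebra.basis (FreeMonoid (Fin 4)) F : FreeMonoid (Fin 4) → T) = ω := by
    funext w
    exact MonoidAlgebra.basis_apply F w
  have hli : LinearIndependent F ω := hbasis ▸
    (MonoidAlgebra.basis (FreeMonoid (Fin 4)) F).linearIndependent
  have hspan : ⊤ ≤ Submodule.span F (Set.range ω) := hbasis ▸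
    (MonoidAlgebra.basis (FreeMonoid (Fin 4)) F).span_eq.ge
  obtain ⟨ε, hε, hεsum⟩ := ENNReal.exists_pos_sum_of_countable' one_ne_zero WordSupport
  choose m hm1 hm using fun W : WordSupport => exists_card_sym_mul_pow_le W.1 (hε W)
  have hlen : ∀ (W : WordSupport) (k : W.1), 1 ≤ (k : FreeMonoid (Fin 4)).length := by
    intro W k
    by_contra h
    have hk : (k : FreeMonoid (Fin 4)) = 1 := FreeMonoid.length_eq_zero.1 (by omega)
    have h1 := k.2
    rw [hk] at h1
    exact W.2 h1
  choose S hS hSpow using fun W : WordSupport => exists_sum_smul_pow_expansion (F := F) (ω := ω)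
    (fun k : W.1 => ω k) (fun k => (k : FreeMonoid (Fin 4)).length)
    (fun k => word_mem_wordSpan (k : FreeMonoid (Fin 4))) (m W)
  have hdeg : ∀ (W : WordSupport) (e : Sym W.1 (m W)),
      m W ≤ ((e : Multiset W.1).map fun k : W.1 => (k : FreeMonoid (Fin 4)).length).sum := by
    intro W e
    simpa using Multiset.card_le_sum_map (e : Multiset W.1) _ (hlen W)
  -- For each support `W` impose the symmetrized `m W`-fold products.
  obtain ⟨I, hI2, hIS, hIfin⟩ := exists_ideal_not_finite_quotient hli hspan
    (ι := (W : WordSupport) × Sym W.1 (m W)) (r := fun x => S x.1 x.2)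
    (d := fun x =>
      ((x.2 : Multiset x.1.1).map fun k : x.1.1 => (k : FreeMonoid (Fin 4)).length).sum)
    (fun x => hS x.1 x.2) (fun x => (hm1 x.1).trans (hdeg x.1 x.2)) (by
      rw [ENNReal.tsum_sigma']
      refine le_trans (ENNReal.tsum_le_tsum fun W => ?_) hεsum.le
      refine le_trans ?_ (hm W)
      rw [tsum_fintype]
      refine (Finset.sum_le_card_nsmul _ _ (2⁻¹ ^ m W) fun e _ => ?_).trans (by simp)
      exact pow_le_pow_of_le_one zero_le (ENNReal.inv_le_one.2 one_le_two) (hdeg W e))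
  let π := Ideal.Quotient.mkₐ F I
  have hker : ∀ x, π x = 0 ↔ x ∈ I := fun x => Ideal.Quotient.eq_zero_iff_mem
  refine ⟨T ⧸ I, inferInstance, inferInstance,
    Finset.univ.image fun a : Fin 4 => π (ω (FreeMonoid.of a)), ?_, hIfin, fun b hb => ?_⟩
  · rw [eq_top_iff]
    rintro x -
    obtain ⟨x, rfl⟩ := Ideal.Quotient.mkₐ_surjective F I x
    have hx : x ∈ Submodule.span F (Set.range ω) := hspan Submodule.mem_top
    induction hx using Submodule.span_induction with
    | mem x h =>
      obtain ⟨w, rfl⟩ := h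
      induction w using FreeMonoid.inductionOn' with
      | one => rw [map_one, map_one]; exact one_mem _
      | of_mul a w ih =>
        rw [map_mul, map_mul]
        exact mul_mem (Algebra.subset_adjoin (by simp [π])) ih
    | zero => rw [map_zero]; exact zero_mem _
    | add x y _ _ hx hy => rw [map_add]; exact add_mem hx hy
    | smul c x _ hx => rw [map_smul]; exact Subalgebra.smul_mem _ hx c
  · obtain ⟨W, c, rfl⟩ : ∃ (W : WordSupport) (c : W.1 → F), b = π (∑ k, c k • ω k) := by
      have : b ∈ (Submodule.span F (ω '' {w | w ≠ 1})).map π.toLinearMap := by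
        induction hb using NonUnitalAlgebra.adjoin_induction with
        | mem x hx =>
          obtain ⟨a, rfl⟩ : ∃ a, π (ω (FreeMonoid.of a)) = x := by simpa using hx
          exact ⟨_, Submodule.subset_span ⟨_, FreeMonoid.of_ne_one a, rfl⟩, rfl⟩
        | add x y _ _ hx hy => exact add_mem hx hy
        | zero => exact zero_mem _
        | mul x y _ _ hx hy =>
          obtain ⟨x, hx, rfl⟩ := hx
          obtain ⟨y, hy, rfl⟩ := hy
          refine ⟨x * y, ?_, map_mul π x y⟩
          have := Submodule.mul_mem_mul hx hy
          rw [Submodule.span_mul_span] at this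
          refine Submodule.span_mono ?_ this
          rintro _ ⟨_, ⟨u, hu, rfl⟩, _, ⟨v, hv, rfl⟩, rfl⟩
          refine ⟨u * v, ?_, map_mul ω u v⟩
          intro h
          have h1 := congrArg FreeMonoid.length h
          rw [FreeMonoid.length_mul, FreeMonoid.length_one] at h1
          exact hu (FreeMonoid.length_eq_zero.1 (by omega))
        | smul c x _ hx => exact Submodule.smul_mem _ c hx
      obtain ⟨x, hx, rfl⟩ := this
      obtain ⟨l, hl, rfl⟩ := (Finsupp.mem_span_image_iff_linearCombination F).1 hx
      refine ⟨⟨l.support, fun h => hl h rfl⟩, fun k => l k, ?_⟩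
      rw [Finsupp.linearCombination_apply, Finsupp.sum, ← Finset.sum_coe_sort]
      rfl
    refine ⟨m W, ?_⟩
    rw [← map_pow, hSpow, hker]
    exact Submodule.sum_mem _ fun e _ => Submodule.smul_of_tower_mem I _ (hIS ⟨W, e⟩)

end NilAlgebra

/-! ### Quasiregularity and the Jacobson radical -/

section Jacobson

lemma Ring.mem_jacobson_of_isUnit_one_add_mul {R : Type*} [Ring R] {x : R}
    (h : ∀ s, IsUnit (1 + x * s)) : x ∈ Ring.jacobson R := by
  rw [← Ideal.jacobson_bot, Ideal.mem_jacobson_iff]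
  intro y
  obtain ⟨v, hv⟩ := (h y).exists_left_inv
  refine ⟨1 - y * v * x, ?_⟩
  have : (1 - y * v * x) * y * x + (1 - y * v * x) - 1 = y * x - y * (v * (1 + x * y)) * x := by
    noncomm_ring
  rw [this, hv]
  simp

lemma Ring.isUnit_one_add_of_mem_jacobson {R : Type*} [Ring R] {x : R}
    (h : x ∈ Ring.jacobson R) : IsUnit (1 + x) := by
  have hleft : ∀ x ∈ Ring.jacobson R, ∃ s, s * (1 + x) = 1 := by
    intro x hx
    rw [← Ideal.jacobson_bot] at hx
    obtain ⟨s, hs⟩ := Ideal.exists_mul_add_sub_mem_of_mem_jacobson x hx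
    exact ⟨s, by rwa [Ideal.mem_bot, sub_eq_zero, add_comm] at hs⟩
  obtain ⟨s, hs⟩ := hleft x h
  have hs' : s = 1 + -(s * x) := by rw [mul_add, mul_one] at hs; rw [← hs]; abel
  obtain ⟨t, ht⟩ := hleft _ (neg_mem ((Ring.jacobson R).mul_mem_left s h))
  rw [← hs'] at ht
  have : t = 1 + x := left_inv_eq_right_inv ht hs
  exact ⟨⟨1 + x, s, by rw [← this, ht], hs⟩, rfl⟩

lemma Ring.isUnit_one_add_of_pow_mem_jacobson {R : Type*} [Ring R] {x : R} {n : ℕ}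
    (h : x ^ n ∈ Ring.jacobson R) : IsUnit (1 + x) := by
  have h1 : IsUnit (1 - (-x) ^ n) := by
    rw [sub_eq_add_neg, neg_pow]
    exact Ring.isUnit_one_add_of_mem_jacobson (neg_mem (Ideal.mul_mem_left _ _ h))
  have h2 : Commute (1 + x) (∑ i ∈ Finset.range n, (-x) ^ i) := by
    have := (mul_neg_geom_sum (-x) n).trans (geom_sum_mul_neg (-x) n).symm
    rwa [sub_neg_eq_add] at this
  rw [← mul_neg_geom_sum, sub_neg_eq_add] at h1
  exact (h2.isUnit_mul_iff.1 h1).1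

/-- The part of the Jacobson radical of the unitization of `S` that lies in `S`, as a set of
elements of the ambient algebra. -/
def radicalPart {F E : Type*} [Field F] [Ring E] [Algebra F E] (S : NonUnitalSubalgebra F E) :
    Set E :=
  {x | ∃ h : x ∈ S, (Unitization.inr (⟨x, h⟩ : S) : Unitization F S) ∈
    Ring.jacobson (Unitization F S)}

section RadicalPart

variable {F E : Type*} [Field F] [Ring E] [Algebra F E] {S : NonUnitalSubalgebra F E} {x z : E}

lemma zero_mem_radicalPart : (0 : E) ∈ radicalPart S :=
  ⟨zero_mem S, (Ring.jacobson (Unitization F S)).zero_mem⟩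

lemma add_mem_radicalPart (hx : x ∈ radicalPart S) (hz : z ∈ radicalPart S) :
    x + z ∈ radicalPart S := by
  obtain ⟨h1, h2⟩ := hx
  obtain ⟨h3, h4⟩ := hz
  refine ⟨add_mem h1 h3, ?_⟩
  simpa [← Unitization.inr_add] using (Ring.jacobson (Unitization F S)).add_mem h2 h4

lemma smul_mem_radicalPart (c : F) (hx : x ∈ radicalPart S) : c • x ∈ radicalPart S := by
  obtain ⟨h1, h2⟩ := hx
  refine ⟨S.smul_mem c h1, ?_⟩
  have := Submodule.smul_of_tower_mem (Ring.jacobson (Unitization F S)) c h2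
  rwa [← Unitization.inr_smul] at this

lemma mul_mem_radicalPart_left (hz : z ∈ S) (hx : x ∈ radicalPart S) :
    z * x ∈ radicalPart S := by
  obtain ⟨h1, h2⟩ := hx
  refine ⟨mul_mem hz h1, ?_⟩
  have := (Ring.jacobson (Unitization F S)).mul_mem_left (Unitization.inr (⟨z, hz⟩ : S)) h2
  rwa [← Unitization.inr_mul] at this

lemma mul_mem_radicalPart_right (hx : x ∈ radicalPart S) (hz : z ∈ S) :
    x * z ∈ radicalPart S := by
  obtain ⟨h1, h2⟩ := hx
  refine ⟨mul_mem h1 hz, ?_⟩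
  have := (Ring.jacobson (Unitization F S)).mul_mem_right (Unitization.inr (⟨z, hz⟩ : S)) h2
  rwa [← Unitization.inr_mul] at this

end RadicalPart

variable {F E A Q : Type*} [Field F] [Ring E] [Algebra F E] [NonUnitalRing A] [Module F A]
  [Ring Q] [Algebra F Q]

/-- If `c` absorbs the algebra `S` into the radical algebra `A`, so that `c z c = ι α c`, then the
right ideal generated by `c` is quasiregular: for `d = c s` with `c s c = ι α c`, the quasi-inverse
of `d` is `-d - ι α' d`, where `α'` is the quasi-inverse of `α`. -/
lemma mem_radicalPart_of_absorbs {S : NonUnitalSubalgebra F E} (hA : IsJacobsonRadical A)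
    (ι : A →ₙₐ[F] E) (hι : ∀ a, ι a ∈ S) {c : E} (hcS : c ∈ S) (hcc : c * c = 0)
    (hcι : ∀ a, c * ι a = 0)
    (hc : ∀ z ∈ S, ∃ α, c * z * c = ι α * c ∧ ∀ a, c * z * ι a = ι (α * a)) :
    c ∈ radicalPart S := by
  refine ⟨hcS, Ring.mem_jacobson_of_isUnit_one_add_mul fun s => ?_⟩
  obtain ⟨l, z, rfl⟩ : ∃ l z, s = Unitization.inl l + Unitization.inr z :=
    ⟨s.fst, s.snd, (Unitization.inl_fst_add_inr_snd_eq s).symm⟩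
  obtain ⟨α, hα1, hα2⟩ := hc z z.2
  obtain ⟨α', h1, h2⟩ := isQuasiregular_iff.1 (hA α)
  set d : E := l • c + c * z with hd
  have hdS : d ∈ S := add_mem (S.smul_mem l hcS) (mul_mem hcS z.2)
  have hdι : ∀ a, d * ι a = ι (α * a) := fun a => by
    rw [hd, add_mul, smul_mul_assoc, hcι, smul_zero, zero_add, hα2]
  have hdd : d * d = ι α * d := by
    have hdc : d * c = ι α * c := by
      rw [hd, add_mul, smul_mul_assoc, hcc, smul_zero, zero_add, hα1]
    calc d * d = l • (d * c) + d * c * z := by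
          conv_lhs => rw [hd, mul_add, mul_smul_comm, ← mul_assoc, ← hd]
      _ = ι α * d := by rw [hdc, hd, mul_add, mul_smul_comm, mul_assoc]
  have hcs : (Unitization.inr (⟨c, hcS⟩ : S) : Unitization F S) *
      (Unitization.inl l + Unitization.inr z) = Unitization.inr (⟨d, hdS⟩ : S) := by
    ext
    · simp
    · simp [hd]
  rw [hcs, ← isQuasiregular_iff_isUnit', isQuasiregular_iff]
  refine ⟨⟨-d - ι α' * d, sub_mem (neg_mem hdS) (mul_mem (hι α') hdS)⟩, Subtype.ext ?_,
    Subtype.ext ?_⟩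
  · have h3 : ι α' * d + ι α * d + ι (α * α') * d = 0 := by
      rw [← add_mul, ← add_mul, ← map_add, ← map_add, h1, map_zero, zero_mul]
    change -d - ι α' * d + d + d * (-d - ι α' * d) = 0
    rw [mul_sub, mul_neg, hdd, ← mul_assoc, hdι, ← neg_eq_zero, ← h3]
    abel
  · have h3 : ι α * d + ι α' * d + ι (α' * α) * d = 0 := by
      rw [← add_mul, ← add_mul, ← map_add, ← map_add, h2, map_zero, zero_mul]
    change d + (-d - ι α' * d) + (-d - ι α' * d) * d = 0
    rw [sub_mul, neg_mul, mul_assoc, hdd, ← mul_assoc, ← map_mul, ← neg_eq_zero, ← h3]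
    abel

/-- An algebra generated by a radical element `c`, an element `y` annihilating the other generators
modulo the radical, and the image of a nil algebra is Jacobson radical. -/
lemma isJacobsonRadical_of_mem_radicalPart {X : Set Q} {π : Q →ₙₐ[F] E} {c y : E}
    {S : NonUnitalSubalgebra F E} (hS : S = NonUnitalAlgebra.adjoin F (π '' X ∪ {c, y}))
    (hX : ∀ b ∈ NonUnitalAlgebra.adjoin F X, IsNilpotent b)
    (hyy : y * y = 0) (hyπ : ∀ q, y * π q = 0) (hc : c ∈ radicalPart S) :
    IsJacobsonRadical S := by
  have hπS : ∀ x ∈ X, π x ∈ S := fun x hx => by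
    rw [hS]; exact NonUnitalAlgebra.subset_adjoin F (Or.inl ⟨x, hx, rfl⟩)
  have hyS : y ∈ S := by
    rw [hS]; exact NonUnitalAlgebra.subset_adjoin F (by simp)
  have hyz : ∀ z ∈ S, y * z ∈ radicalPart S := by
    intro z hz
    rw [hS] at hz
    induction hz using NonUnitalAlgebra.adjoin_induction with
    | mem x hx =>
      rcases hx with ⟨q, hq, rfl⟩ | rfl | rfl
      · rw [hyπ]; exact zero_mem_radicalPart
      · exact mul_mem_radicalPart_left hyS hc
      · rw [hyy]; exact zero_mem_radicalPart
    | add x z hx' hz' hx hz =>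
      rw [mul_add]; exact add_mem_radicalPart hx hz
    | zero => rw [mul_zero]; exact zero_mem_radicalPart
    | mul x z hx' hz' hx hz =>
      rw [← hS] at hz'
      rw [← mul_assoc]; exact mul_mem_radicalPart_right hx hz'
    | smul l x hx' hx =>
      rw [mul_smul_comm]; exact smul_mem_radicalPart l hx
  have hy : y ∈ radicalPart S := by
    refine ⟨hyS, Ring.mem_jacobson_of_isUnit_one_add_mul fun s => ?_⟩
    obtain ⟨l, z, rfl⟩ : ∃ l z, s = Unitization.inl l + Unitization.inr z :=
      ⟨s.fst, s.snd, (Unitization.inl_fst_add_inr_snd_eq s).symm⟩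
    obtain ⟨h1, h2⟩ := mul_mem_radicalPart_right (hyz z z.2) hyS
    -- For `s = l + z` one has `y * s * y = y * z * y`, so `(y * s) ^ 2` is in the radical.
    refine Ring.isUnit_one_add_of_pow_mem_jacobson (n := 2) ?_
    have h3 : (Unitization.inr (⟨y, hyS⟩ : S) : Unitization F S) *
        (Unitization.inl l + Unitization.inr z) * Unitization.inr (⟨y, hyS⟩ : S) =
        Unitization.inr (⟨y * z * y, h1⟩ : S) := by
      ext
      · simp
      · simp [add_mul, hyy]
    rw [sq, ← mul_assoc, h3]
    exact Ideal.mul_mem_right _ _ h2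
  -- Modulo the radical, `S` is the image of the nil algebra generated by `X`.
  have hmod : ∀ z ∈ S, ∃ b ∈ NonUnitalAlgebra.adjoin F X, π b ∈ S ∧ z - π b ∈ radicalPart S := by
    intro z hz
    rw [hS] at hz
    induction hz using NonUnitalAlgebra.adjoin_induction with
    | mem x hx =>
      rcases hx with ⟨q, hq, rfl⟩ | rfl | rfl
      · exact ⟨q, NonUnitalAlgebra.subset_adjoin F hq, hπS q hq, by
          rw [sub_self]; exact zero_mem_radicalPart⟩
      · exact ⟨0, zero_mem _, by rw [map_zero]; exact zero_mem S, by rwa [map_zero, sub_zero]⟩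
      · exact ⟨0, zero_mem _, by rw [map_zero]; exact zero_mem S, by rwa [map_zero, sub_zero]⟩
    | add x z hx' hz' hx hz =>
      obtain ⟨b, hb, hbS, hxb⟩ := hx
      obtain ⟨e, he, heS, hze⟩ := hz
      refine ⟨b + e, add_mem hb he, by rw [map_add]; exact add_mem hbS heS, ?_⟩
      rw [map_add, add_sub_add_comm]
      exact add_mem_radicalPart hxb hze
    | zero =>
      exact ⟨0, zero_mem _, by rw [map_zero]; exact zero_mem S, by
        rw [map_zero, sub_zero]; exact zero_mem_radicalPart⟩
    | mul x z hx' hz' hx hz =>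
      rw [← hS] at hx' hz'
      obtain ⟨b, hb, hbS, hxb⟩ := hx
      obtain ⟨e, he, heS, hze⟩ := hz
      refine ⟨b * e, mul_mem hb he, by rw [map_mul]; exact mul_mem hbS heS, ?_⟩
      have : x * z - π (b * e) = (x - π b) * z + π b * (z - π e) := by
        rw [map_mul]; noncomm_ring
      rw [this]
      exact add_mem_radicalPart (mul_mem_radicalPart_right hxb hz')
        (mul_mem_radicalPart_left hbS hze)
    | smul l x hx' hx =>
      obtain ⟨b, hb, hbS, hxb⟩ := hx
      refine ⟨l • b, SMulMemClass.smul_mem l hb, by rw [map_smul]; exact S.smul_mem l hbS, ?_⟩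
      rw [map_smul, ← smul_sub]
      exact smul_mem_radicalPart l hxb
  intro z
  obtain ⟨b, hb, hbS, h1, h2⟩ := hmod z z.2
  obtain ⟨n, hn⟩ := hX b hb
  have hpow : ∀ n, ∃ h : π (b ^ (n + 1)) ∈ S,
      (Unitization.inr (⟨π b, hbS⟩ : S) : Unitization F S) ^ (n + 1) =
        Unitization.inr (⟨π (b ^ (n + 1)), h⟩ : S) := by
    intro n
    induction n with
    | zero => simpa using hbS
    | succ n ih =>
      obtain ⟨h, ih⟩ := ih
      refine ⟨by rw [pow_succ, map_mul]; exact mul_mem h hbS, ?_⟩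
      rw [pow_succ, ih, ← Unitization.inr_mul]
      congr 1
      refine Subtype.ext ?_
      change π (b ^ (n + 1)) * π b = π (b ^ (n + 1 + 1))
      rw [← map_mul, ← pow_succ]
  rw [isQuasiregular_iff_isUnit' F]
  refine Ring.isUnit_one_add_of_pow_mem_jacobson (n := n + 1) ?_
  rw [← Ideal.Quotient.eq_zero_iff_mem, map_pow]
  have h3 : Ideal.Quotient.mk (Ring.jacobson (Unitization F S)) (Unitization.inr z) =
      Ideal.Quotient.mk _ (Unitization.inr (⟨π b, hbS⟩ : S)) := by
    rw [Ideal.Quotient.eq, ← Unitization.inr_sub]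
    exact h2
  obtain ⟨h, h4⟩ := hpow n
  rw [h3, ← map_pow, h4]
  have h5 : (⟨π (b ^ (n + 1)), h⟩ : S) = 0 := Subtype.ext (by simp [pow_succ, hn])
  rw [h5, Unitization.inr_zero, map_zero]

end Jacobson

/-! ### The matrix wreath product -/

section Wreath

open scoped TensorProduct

universe w

variable (F : Type u) [Field F] (A : Type v) [NonUnitalRing A] [Module F A]
  (Q : Type u) [Ring Q] [Algebra F Q]

/-- The space on which the matrix wreath product acts: a right `Unitization F A`-module
with one distinguished coordinate and the coordinates indexed by (a basis of) `Q`. -/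
abbrev WreathSpace : Type (max u v) := Unitization F A × (Q ⊗[F] Unitization F A)

namespace WreathSpace

/-- `Q` acting by left multiplication on the other coordinates. -/
noncomputable def diag : Q →ₙₐ[F] Module.End F (WreathSpace F A Q) where
  toFun q := LinearMap.prodMap 0 ((LinearMap.mulLeft F q).rTensor (Unitization F A))
  map_smul' l a := by
    ext x <;> simp [TensorProduct.smul_tmul']
  map_zero' := by
    ext x <;> simp
  map_add' a b := by
    ext x <;> simp [add_mul, TensorProduct.add_tmul]
  map_mul' a b := by
    ext x <;> simp

/-- The column with the entry `1` at the coordinate `1` of `Q`. -/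
noncomputable def column : Module.End F (WreathSpace F A Q) :=
  LinearMap.inr F _ _ ∘ₗ TensorProduct.mk F Q (Unitization F A) 1 ∘ₗ LinearMap.fst F _ _

variable {F A Q}

@[simp] lemma diag_apply (q : Q) (x : WreathSpace F A Q) :
    diag F A Q q x = (0, (LinearMap.mulLeft F q).rTensor (Unitization F A) x.2) := rfl

@[simp] lemma column_apply (x : WreathSpace F A Q) : column F A Q x = (0, 1 ⊗ₜ x.1) := rfl

lemma column_mul_column : column F A Q * column F A Q = 0 := by
  ext x <;> simp

lemma column_mul_diag (q : Q) : column F A Q * diag F A Q q = 0 := by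
  ext x <;> simp

variable [IsScalarTower F A A] [SMulCommClass F A A]

variable (F A Q) in
/-- Right multiplication by `p`. -/
noncomputable def mulRight (p : Unitization F A) : Module.End F (WreathSpace F A Q) :=
  (LinearMap.mulRight F p).prodMap ((LinearMap.mulRight F p).lTensor Q)

variable (F A Q) in
/-- `A` acting by left multiplication on the distinguished coordinate. -/
noncomputable def corner : A →ₙₐ[F] Module.End F (WreathSpace F A Q) where
  toFun a := (LinearMap.mulLeft F (Unitization.inr a)).prodMap 0
  map_smul' l a := by
    ext x <;> simp
  map_zero' := by
    ext x <;> simp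
  map_add' a b := by
    ext x <;> simp [add_mul]
  map_mul' a b := by
    ext x <;> simp

/-- The functional `q ⊗ p ↦ γ q * p`. -/
noncomputable def rowFunctional (γ : Q →ₗ[F] A) : Q ⊗[F] Unitization F A →ₗ[F] Unitization F A :=
  TensorProduct.lift (LinearMap.mul F (Unitization F A) ∘ₗ Unitization.inrHom F F A ∘ₗ γ)

/-- The row with the entry `γ q` at the coordinate `q`. -/
noncomputable def row (γ : Q →ₗ[F] A) : Module.End F (WreathSpace F A Q) :=
  LinearMap.inl F _ _ ∘ₗ rowFunctional γ ∘ₗ LinearMap.snd F _ _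

@[simp] lemma mulRight_apply (p : Unitization F A) (x : WreathSpace F A Q) :
    mulRight F A Q p x = (x.1 * p, (LinearMap.mulRight F p).lTensor Q x.2) := rfl

@[simp] lemma corner_apply (a : A) (x : WreathSpace F A Q) :
    corner F A Q a x = (a * x.1, 0) := rfl

@[simp] lemma row_apply (γ : Q →ₗ[F] A) (x : WreathSpace F A Q) :
    row γ x = (rowFunctional γ x.2, 0) := rfl

@[simp] lemma rowFunctional_tmul (γ : Q →ₗ[F] A) (q : Q) (p : Unitization F A) :
    rowFunctional γ (q ⊗ₜ p) = γ q * p := rfl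

lemma rowFunctional_lTensor (γ : Q →ₗ[F] A) (p : Unitization F A) (t : Q ⊗[F] Unitization F A) :
    rowFunctional γ ((LinearMap.mulRight F p).lTensor Q t) = rowFunctional γ t * p := by
  induction t with
  | zero => simp
  | tmul q u => simp [mul_assoc]
  | add s t hs ht => simp [hs, ht, add_mul]

lemma exists_rowFunctional_eq_inr (γ : Q →ₗ[F] A) (t : Q ⊗[F] Unitization F A) :
    ∃ α : A, rowFunctional γ t = α := by
  refine ⟨(rowFunctional γ t).snd, ?_⟩
  have : (rowFunctional γ t).fst = 0 := by
    induction t with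
    | zero => simp
    | tmul q u => simp
    | add s t hs ht => simp [hs, ht]
  ext <;> simp [this]

lemma corner_injective : Function.Injective (corner F A Q) := by
  intro a b h
  have := congrArg (fun f => (f (1, 0)).1) h
  simpa [Unitization.inr_injective.eq_iff] using this

lemma row_mul_row (γ : Q →ₗ[F] A) : row γ * row γ = 0 := by
  ext x <;> simp

lemma row_mul_corner (γ : Q →ₗ[F] A) (a : A) : row γ * corner F A Q a = 0 := by
  ext x <;> simp

lemma row_mul_column (γ : Q →ₗ[F] A) : row γ * column F A Q = corner F A Q (γ 1) := by
  ext x <;> simp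

lemma row_mul_diag_mul_column (γ : Q →ₗ[F] A) (q : Q) :
    row γ * diag F A Q q * column F A Q = corner F A Q (γ q) := by
  ext x <;> simp

/-- Here `α` is the distinguished entry of `row * z`: an operator commuting with right
multiplications is determined on the distinguished coordinate by its value at `(1, 0)`. -/
lemma row_mul_absorbs (γ : Q →ₗ[F] A) (z : Module.End F (WreathSpace F A Q))
    (hz : ∀ p, Commute z (mulRight F A Q p)) :
    ∃ α, row γ * z * row γ = corner F A Q α * row γ ∧
      ∀ a, row γ * z * corner F A Q a = corner F A Q (α * a) := by
  obtain ⟨α, hα⟩ := exists_rowFunctional_eq_inr γ (z (1, 0)).2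
  have key : ∀ p, rowFunctional γ (z (p, 0)).2 = α * p := by
    intro p
    have h1 := LinearMap.congr_fun (hz p).eq (1, 0)
    simp only [Module.End.mul_apply, mulRight_apply, one_mul, map_zero] at h1
    rw [h1, rowFunctional_lTensor, hα]
  refine ⟨α, ?_, fun a => ?_⟩
  · refine LinearMap.ext fun x => ?_
    simp [key]
  · refine LinearMap.ext fun x => ?_
    simp [key, mul_assoc]

lemma commute_mulRight_of_mem_adjoin (γ : Q →ₗ[F] A) (X : Set Q)
    {z : Module.End F (WreathSpace F A Q)}
    (hz : z ∈ NonUnitalAlgebra.adjoin F (diag F A Q '' X ∪ {row γ, column F A Q}))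
    (p : Unitization F A) : Commute z (mulRight F A Q p) := by
  induction hz using NonUnitalAlgebra.adjoin_induction with
  | mem x hx =>
    rcases hx with ⟨q, hq, rfl⟩ | rfl | rfl
    · ext x <;> simp
    · refine LinearMap.ext fun x => ?_
      simp [rowFunctional_lTensor]
    · ext x <;> simp
  | add x z _ _ hx hz => exact hx.add_left hz
  | zero => exact Commute.zero_left _
  | mul x z _ _ hx hz => exact hx.mul_left hz
  | smul l x _ hx => exact hx.smul_left l

/-- The corner entries `γ q` arise as `row * q * column`. -/
lemma corner_mem_adjoin (γ : Q →ₗ[F] A) {X : Set Q} (hX : Algebra.adjoin F X = ⊤) (q : Q) :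
    corner F A Q (γ q) ∈
      NonUnitalAlgebra.adjoin F (diag F A Q '' X ∪ {row γ, column F A Q}) := by
  set S := NonUnitalAlgebra.adjoin F (diag F A Q '' X ∪ {row γ, column F A Q}) with hS
  have hrow : row γ ∈ S := NonUnitalAlgebra.subset_adjoin F (by simp)
  have hcol : column F A Q ∈ S := NonUnitalAlgebra.subset_adjoin F (by simp)
  -- A nonempty word in the generators acts through `S`; the empty word is handled separately.
  have hq : q ∈ Submodule.span F (Submonoid.closure X : Set Q) := by
    rw [← Algebra.adjoin_eq_span, hX]; exact Submodule.mem_top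
  have hdiag : ∀ x ∈ Submonoid.closure X, x = 1 ∨ diag F A Q x ∈ S := by
    intro x hx
    induction hx using Submonoid.closure_induction with
    | mem x hx => exact Or.inr (NonUnitalAlgebra.subset_adjoin F (Or.inl ⟨x, hx, rfl⟩))
    | one => exact Or.inl rfl
    | mul x y _ _ hx hy =>
      rcases hx with rfl | hx
      · rwa [one_mul]
      · rcases hy with rfl | hy
        · rw [mul_one]; exact Or.inr hx
        · rw [map_mul]; exact Or.inr (mul_mem hx hy)
  induction hq using Submodule.span_induction with
  | mem x hx =>
    rcases hdiag x hx with rfl | hx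
    · rw [← row_mul_column]; exact mul_mem hrow hcol
    · rw [← row_mul_diag_mul_column]; exact mul_mem (mul_mem hrow hx) hcol
  | zero => rw [map_zero, map_zero]; exact zero_mem S
  | add x y _ _ hx hy => rw [map_add, map_add]; exact add_mem hx hy
  | smul l x _ hx => rw [map_smul, map_smul]; exact S.smul_mem l hx

end WreathSpace

/-- A space of countable dimension is a linear image of any infinite-dimensional space. -/
lemma exists_surjective_of_not_finite (F : Type u) [Field F] (A : Type v) [AddCommGroup A]
    [Module F A] (hA : Module.rank F A ≤ Cardinal.aleph0) (Q : Type u) [AddCommGroup Q]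
    [Module F Q] (hQ : ¬ Module.Finite F Q) : ∃ γ : Q →ₗ[F] A, Function.Surjective γ := by
  have h1 : Cardinal.aleph0 ≤ Module.rank F Q := by
    rw [← not_lt, Module.rank_lt_aleph0_iff]; exact hQ
  have h2 : Cardinal.lift.{u} (Module.rank F A) ≤ Cardinal.lift.{v} (Module.rank F Q) :=
    (Cardinal.lift_le_aleph0.2 hA).trans (Cardinal.aleph0_le_lift.2 h1)
  obtain ⟨f, hf⟩ := lift_rank_le_iff_exists_linearMap.1 h2
  obtain ⟨γ, hγ⟩ := f.exists_leftInverse_of_injective (LinearMap.ker_eq_bot.2 hf)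
  exact ⟨γ, fun a => ⟨f a, LinearMap.congr_fun hγ a⟩⟩

end Wreath

/-! ### Finite generation and the embedding -/

section FiniteGeneration

open Classical in
lemma isFinitelyGeneratedAlgebra_adjoin (F : Type*) {E : Type*} [Field F] [NonUnitalRing E]
    [Module F E] [IsScalarTower F E E] [SMulCommClass F E E] (G : Finset E) :
    IsFinitelyGeneratedAlgebra F (NonUnitalAlgebra.adjoin F (G : Set E)) := by
  refine ⟨G.subtype (· ∈ NonUnitalAlgebra.adjoin F (G : Set E)), ?_⟩
  rw [eq_top_iff]
  rintro ⟨x, hx⟩ -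
  induction hx using NonUnitalAlgebra.adjoin_induction with
  | mem x hx => exact NonUnitalAlgebra.subset_adjoin F (by simpa using hx)
  | add x y _ _ hx hy => exact add_mem hx hy
  | zero => exact zero_mem _
  | mul x y _ _ hx hy => exact mul_mem hx hy
  | smul l x _ hx => exact SMulMemClass.smul_mem l hx

lemma exists_embedding_of_le_adjoin {F : Type u} {A : Type v} {E : Type w} [Field F]
    [NonUnitalRing A] [Module F A] [Ring E] [Algebra F E] (G : Finset E) (φ : A →ₙₐ[F] E)
    (hφ : Function.Injective φ) (hφG : ∀ a, φ a ∈ NonUnitalAlgebra.adjoin F (G : Set E))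
    (hG : IsJacobsonRadical (NonUnitalAlgebra.adjoin F (G : Set E))) :
    ∃ (C : Type w) (_ : NonUnitalRing C) (_ : Module F C)
      (_ : IsScalarTower F C C) (_ : SMulCommClass F C C),
      IsFinitelyGeneratedAlgebra F C ∧ IsJacobsonRadical C ∧
        ∃ φ : A →ₙₐ[F] C, Function.Injective φ :=
  ⟨NonUnitalAlgebra.adjoin F (G : Set E), inferInstance, inferInstance, inferInstance,
    inferInstance, isFinitelyGeneratedAlgebra_adjoin F G, hG,
    NonUnitalAlgHom.codRestrict φ _ hφG, fun _ _ h => hφ (congrArg Subtype.val h)⟩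

end FiniteGeneration

theorem theorem4p1 (F : Type u) [Field F]
    (A : Type v) [NonUnitalRing A] [Module F A] [IsScalarTower F A A] [SMulCommClass F A A]
    (hdim : Module.rank F A ≤ Cardinal.aleph0) (hA : IsJacobsonRadical A) :
    ∃ (C : Type (max u v)) (_ : NonUnitalRing C) (_ : Module F C)
      (_ : IsScalarTower F C C) (_ : SMulCommClass F C C),
      IsFinitelyGeneratedAlgebra F C ∧ IsJacobsonRadical C ∧
        ∃ φ : A →ₙₐ[F] C, Function.Injective φ := by
  classical
  obtain ⟨Q, _, _, X, hX, hQ, hnil⟩ := exists_infinite_dimensional_nil F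
  obtain ⟨γ, hγ⟩ := exists_surjective_of_not_finite F A hdim Q hQ
  set G : Finset (Module.End F (WreathSpace F A Q)) :=
    X.image (WreathSpace.diag F A Q) ∪ {WreathSpace.row γ, WreathSpace.column F A Q} with hG
  have hGcoe : (G : Set (Module.End F (WreathSpace F A Q))) =
      WreathSpace.diag F A Q '' X ∪ {WreathSpace.row γ, WreathSpace.column F A Q} := by
    simp [hG]
  set S := NonUnitalAlgebra.adjoin F (G : Set (Module.End F (WreathSpace F A Q))) with hS
  have hcorner : ∀ a, WreathSpace.corner F A Q a ∈ S := fun a => by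
    obtain ⟨q, rfl⟩ := hγ a
    rw [hS, hGcoe]
    exact WreathSpace.corner_mem_adjoin γ hX q
  refine exists_embedding_of_le_adjoin G (WreathSpace.corner F A Q)
    WreathSpace.corner_injective hcorner ?_
  refine isJacobsonRadical_of_mem_radicalPart (hS.trans (by rw [hGcoe])) hnil
      WreathSpace.column_mul_column WreathSpace.column_mul_diag
      (mem_radicalPart_of_absorbs hA (WreathSpace.corner F A Q) hcorner
        (NonUnitalAlgebra.subset_adjoin F (by simp [hG])) (WreathSpace.row_mul_row γ)
        (WreathSpace.row_mul_corner γ) fun z hz => WreathSpace.row_mul_absorbs γ z fun p =>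
          WreathSpace.commute_mulRight_of_mem_adjoin γ X (by rwa [hS, hGcoe] at hz) p)
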